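/- Hyperreal categoricity theorem. Assume the continuum hypothesis $2^{\aleph_0}=\aleph_1$ (on top of ZFC). Call a field $K$ countably saturated (that is, $\aleph_1$-saturated) if, for every countable set $A\subseteq K$ and every $n\in\mathbb N$, each set $p$ of first-order formulas in $n$ free variables in the language of rings with parameters from $A$, every finite subset of which is satisfied by some $n$-tuple of elements of $K$, is satisfied in its entirety by a single $n$-tuple of elements of $K$. (In a real-closed field the order is definable in the language of rings, by $x\le y$ if and only if $y-x$ is a square, so this is the same as saturation as an ordered field.) Call a countably saturated real-closed field smallest if its cardinality is at most the cardinality of every countably saturated real-closed field. Then there is, up to isomorphism, exactly one smallest countably saturated real-closed field, and its cardinality is $2^{\aleph_0}$. That is, there is a smallest countably saturated real-closed field $K$, it satisfies $|K|=2^{\aleph_0}$, and every smallest countably saturated real-closed field is isomorphic to $K$. -/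

import Mathlib

open scoped FirstOrder Cardinal

universe u v w x

/-- An `L`-structure `M` is countably saturated (that is, `ℵ₁`-saturated) if it realizes every type
with countably many parameters: whenever `A ⊆ M` is countable and `p` is a set of first-order
formulas in `n` free variables with parameters from `A` such that every finite subset of `p` is
satisfied by some `n`-tuple of `M`, a single `n`-tuple of `M` satisfies all of `p`. -/
def IsCountablySaturated (L : FirstOrder.Language.{u, v}) (M : Type w) [L.Structure M] : Prop :=
  ∀ A : Set M, A.Countable → ∀ (n : ℕ) (p : Set (L[[A]].Formula (Fin n))),
    (∀ p₀ : Finset (L[[A]].Formula (Fin n)), (p₀ : Set (L[[A]].Formula (Fin n))) ⊆ p →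
      ∃ a : Fin n → M, ∀ φ ∈ p₀, φ.Realize a) →
    ∃ a : Fin n → M, ∀ φ ∈ p, φ.Realize a

/-- A field is countably saturated if it is so as a structure in the first-order language
`(+, *, -, 0, 1)` of rings. In a real-closed field the order is definable in this language, since
`x ≤ y` holds exactly when `y - x` is a square. -/
def IsCountablySaturatedField (K : Type w) [Field K] : Prop :=
  letI := FirstOrder.Ring.compatibleRingOfRing K
  IsCountablySaturated FirstOrder.Language.ring K

/-- `K` is a smallest countably saturated real-closed field: it is a countably saturated real-closed
field whose cardinality is at most that of every countably saturated real-closed field. -/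
structure IsSmallestCountablySaturatedRCF (K : Type w) [Field K] : Prop where
  isRealClosed : IsRealClosed K
  isCountablySaturated : IsCountablySaturatedField K
  card_le : ∀ (F : Type w) [Field F], IsRealClosed F → IsCountablySaturatedField F → #K ≤ #F

/-!
A real-closed field is ordered by its squares, and countable saturation, applied to the formulas
saying that an element lies between prescribed ones, shows that every cut between countable sets is
filled (`IsCountablySaturatedField.fillsCountableCuts`). Hence a countably saturated real-closed
field has at least `ℵ₁` elements. The ultrapower of `ℝ` along a nonprincipal ultrafilter on `ℕ` is
real closed, countably saturated by Łoś's theorem (`isCountablySaturated_ultrapower`), and has at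
most `2 ^ ℵ₀` elements; if `2 ^ ℵ₀ = ℵ₁` it is therefore a smallest such field, and every smallest
one has `ℵ₁` elements.

Two real-closed fields `K` and `F` of size `ℵ₁` that fill their countable cuts are isomorphic by a
back-and-forth of length `ω₁` (`nonempty_ringEquiv_of_fillsCountableCuts`) along countable partial
isomorphisms, which are recorded by their graphs in `K × F`. To extend one by an element `a` of `K`,
the field of definition is first enlarged to its relative algebraic closure in `K`, which is real
closed; if `a` is still not in it, then `a` is matched with any `b` in the corresponding cut of `F`.
The pair `(a, b)` gives polynomials the same sign, since over a real-closed field irreducible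
polynomials have degree at most two (`IsRealClosed.sameSign_aeval`).

The enlargement to the relative algebraic closure needs the fact that an algebraic extension of an
ordered field `E` that embeds into one real-closed extension of `E` embeds into every other
(`IsRealClosed.nonempty_algHom_of_isAlgebraic`). For a finite extension `A` of `E` the existence of
an embedding into a real-closed extension `R` is read off from the signature of the trace form of
`A`, which does not depend on `R`
(`IsRealClosed.nonempty_algHom_iff_card_neg_lt_card_pos`): over `R(i)` the trace form is a sum of
squares indexed by the embeddings of `A` into `R(i)`, in which real embeddings contribute positive
squares and conjugate pairs contribute one square of each sign. That `R(i)` is algebraically closed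
is the classical argument from Galois theory and Sylow's theorem.
-/

/-! ### The order of a real-closed field -/

namespace IsRealClosed

section Order

variable {R : Type*} [Field R] [IsRealClosed R]

theorem eq_zero_of_isSquare_of_isSquare_neg {x : R} (hx : IsSquare x) (hx' : IsSquare (-x)) :
    x = 0 := by
  obtain ⟨a, rfl⟩ := hx
  obtain ⟨b, hb⟩ := hx'
  by_contra ha
  have ha : a ≠ 0 := fun h => ha (by simp [h])
  refine IsSemireal.not_isSumSq_neg_one (R := R) (IsSquare.isSumSq ⟨b / a, ?_⟩)
  field_simp
  linear_combination hb

theorem isSquare_add {x y : R} (hx : IsSquare x) (hy : IsSquare y) : IsSquare (x + y) := by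
  obtain h | ⟨c, hc⟩ := isSquare_or_isSquare_neg (x + y)
  · exact h
  obtain ⟨a, rfl⟩ := hx
  obtain ⟨b, rfl⟩ := hy
  by_cases hc0 : c = 0
  · exact ⟨0, by linear_combination -hc - c * hc0⟩
  · refine absurd ?_ (IsSemireal.not_isSumSq_neg_one (R := R))
    have : (-1 : R) = a / c * (a / c) + b / c * (b / c) := by
      field_simp
      linear_combination hc
    rw [this]
    exact (IsSquare.isSumSq ⟨_, rfl⟩).add (IsSquare.isSumSq ⟨_, rfl⟩)

variable (R) in
/-- The order of a real-closed field: `x ≤ y` when `y - x` is a square. -/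
@[reducible]
noncomputable def linearOrder : LinearOrder R where
  le x y := IsSquare (y - x)
  le_refl x := by simp
  le_trans x y z hxy hyz := by simpa using isSquare_add hyz hxy
  le_antisymm x y hxy hyx := by
    refine (sub_eq_zero.1 (eq_zero_of_isSquare_of_isSquare_neg hxy ?_)).symm
    simpa using hyx
  le_total x y := by simpa using isSquare_or_isSquare_neg (y - x)
  toDecidableLE := Classical.decRel _

theorem isStrictOrderedRing :
    let := linearOrder R
    IsStrictOrderedRing R := by
  let := linearOrder R
  have hle : ∀ x y : R, x ≤ y ↔ IsSquare (y - x) := fun _ _ => Iff.rfl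
  have : IsOrderedAddMonoid R := ⟨fun a b h c => by simpa [hle] using h, fun a b h c => by
    simpa [hle] using h⟩
  have : ZeroLEOneClass R := ⟨by simp [hle]⟩
  refine IsStrictOrderedRing.of_mul_pos fun a b ha hb => lt_of_le_of_ne ?_ ?_
  · have := IsSquare.mul ((hle _ _).1 ha.le) ((hle _ _).1 hb.le)
    simpa [hle] using this
  · exact (mul_ne_zero ha.ne' hb.ne').symm

end Order

/-! ### The algebraic closure of a real-closed field -/

section AlgClosed

/-- A real-closed field has no proper extension of odd degree: the minimal polynomial of a primitive
element has a root. -/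
theorem finrank_eq_one_of_odd {R : Type*} [Field R] [IsRealClosed R] [CharZero R]
    {F : Type*} [Field F] [Algebra R F] [FiniteDimensional R F] (h : Odd (Module.finrank R F)) :
    Module.finrank R F = 1 := by
  obtain ⟨α, hα⟩ := Field.exists_primitive_element R F
  have hint : IsIntegral R α := Algebra.IsIntegral.isIntegral α
  have hdeg : (minpoly R α).natDegree = Module.finrank R F := by
    rw [← IntermediateField.adjoin.finrank hint, hα, IntermediateField.finrank_top']
  obtain ⟨x, hx⟩ := exists_isRoot_of_odd_natDegree (hdeg ▸ h)
  rw [← hdeg]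
  exact Polynomial.natDegree_eq_of_degree_eq_some
    (Polynomial.degree_eq_one_of_irreducible_of_root (minpoly.irreducible hint) hx)

theorem finrank_ne_two_of_forall_isSquare {C M : Type*} [Field C] [CharZero C] [Field M]
    [Algebra C M] (hC : ∀ z : C, IsSquare z) : Module.finrank C M ≠ 2 := by
  intro h
  have : FiniteDimensional C M := FiniteDimensional.of_finrank_pos (by omega)
  obtain ⟨α, hα⟩ := Field.exists_primitive_element C M
  have hint : IsIntegral C α := Algebra.IsIntegral.isIntegral α
  have hdeg : (minpoly C α).natDegree = 2 := by
    rw [← IntermediateField.adjoin.finrank hint, hα, IntermediateField.finrank_top', h]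
  obtain ⟨s, hs⟩ := hC (discrim ((minpoly C α).coeff 2) ((minpoly C α).coeff 1)
    ((minpoly C α).coeff 0))
  have h2 : (minpoly C α).coeff 2 = 1 := by
    rw [← hdeg]; exact minpoly.monic hint
  obtain ⟨x, hx⟩ := exists_quadratic_eq_zero (a := (minpoly C α).coeff 2) (by simp [h2]) ⟨s, hs⟩
  have hroot : (minpoly C α).IsRoot x := by
    rw [Polynomial.IsRoot, Polynomial.eval_eq_sum_range, hdeg]
    simp only [Finset.sum_range_succ, Finset.sum_range_zero]
    linear_combination hx
  have := Polynomial.natDegree_eq_of_degree_eq_some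
    (Polynomial.degree_eq_one_of_irreducible_of_root (minpoly.irreducible hint) hroot)
  rw [hdeg] at this
  exact absurd this (by decide)

variable {R : Type*} [Field R] [LinearOrder R] [IsStrictOrderedRing R]

instance fact_sq_ne_neg_one : Fact (∀ r : R, r ^ 2 ≠ -1 + 0 * r) :=
  ⟨fun r h => by nlinarith [sq_nonneg r]⟩

variable [IsRealClosed R]

theorem isSquare_quadraticAlgebra (z : QuadraticAlgebra R (-1) 0) : IsSquare z := by
  obtain ⟨a, b⟩ := z
  obtain ⟨s', hs'⟩ := IsSquare.of_nonneg (R := R)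
    (add_nonneg (mul_self_nonneg a) (mul_self_nonneg b))
  obtain ⟨s, hs0, hs⟩ : ∃ s : R, 0 ≤ s ∧ s * s = a * a + b * b := ⟨|s'|, abs_nonneg _, by
    rw [abs_mul_abs_self, hs']⟩
  have h1 : |a| ≤ s := abs_le_of_sq_le_sq (by nlinarith [mul_self_nonneg b]) hs0
  obtain ⟨x, hx⟩ := IsSquare.of_nonneg (R := R) (x := (s + a) / 2)
    (by linarith [neg_abs_le a])
  obtain ⟨y, hy⟩ := IsSquare.of_nonneg (R := R) (x := (s - a) / 2)
    (by linarith [le_abs_self a])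
  have hxy : (2 * (x * y)) ^ 2 = b ^ 2 := by
    calc (2 * (x * y)) ^ 2 = 4 * ((x * x) * (y * y)) := by ring
      _ = b ^ 2 := by rw [← hx, ← hy]; linear_combination hs
  rcases sq_eq_sq_iff_eq_or_eq_neg.1 hxy with h | h
  · refine ⟨⟨x, y⟩, ?_⟩
    ext
    · simp; linear_combination hx - hy
    · simp; linear_combination -h
  · refine ⟨⟨x, -y⟩, ?_⟩
    ext
    · simp; linear_combination hx - hy
    · simp; linear_combination h

/-- A finite Galois extension of `R` containing `R(i)` equals `R(i)`: its Galois group is a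
`2`-group since `R` has no proper extension of odd degree, so a proper extension of `R(i)` would
contain a quadratic one, while every element of `R(i)` is already a square. -/
theorem finrank_eq_one_of_isGalois {N : Type*} [Field N] [Algebra R N]
    [Algebra (QuadraticAlgebra R (-1) 0) N] [IsScalarTower R (QuadraticAlgebra R (-1) 0) N]
    [FiniteDimensional R N] [IsGalois R N] :
    Module.finrank (QuadraticAlgebra R (-1) 0) N = 1 := by
  set C := QuadraticAlgebra R (-1) 0 with hCdef
  have : FiniteDimensional C N := Module.Finite.of_restrictScalars_finite R C N
  have : IsGalois C N := IsGalois.tower_top_of_isGalois R C N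
  have : CharZero C := charZero_of_injective_algebraMap (algebraMap R C).injective
  obtain ⟨P⟩ : Nonempty (Sylow 2 Gal(N/R)) := inferInstance
  -- the fixed field of a Sylow `2`-subgroup has odd degree over `R`
  have hodd : Odd (Module.finrank R (IntermediateField.fixedField (P : Subgroup Gal(N/R)))) := by
    rw [IntermediateField.finrank_eq_fixingSubgroup_index,
      IntermediateField.fixingSubgroup_fixedField]
    exact Nat.odd_iff.2 (Nat.two_dvd_ne_zero.1 P.not_dvd_index)
  have hone := finrank_eq_one_of_odd hodd
  obtain ⟨n, hn⟩ : ∃ n, Module.finrank R N = 2 ^ n := by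
    obtain ⟨n, hn⟩ := IsPGroup.iff_card.1 P.isPGroup'
    refine ⟨n, ?_⟩
    rw [← Module.finrank_mul_finrank R (IntermediateField.fixedField (P : Subgroup Gal(N/R))) N,
      hone, one_mul, IntermediateField.finrank_fixedField_eq_card]
    exact hn
  have htower := Module.finrank_mul_finrank R C N
  rw [hn, QuadraticAlgebra.finrank_eq_two] at htower
  obtain _ | _ | n := n
  · omega
  · simpa using htower
  exfalso
  have hcard : Nat.card Gal(N/C) = 2 ^ (n + 1) := by
    rw [IsGalois.card_aut_eq_finrank]
    rw [pow_succ'] at htower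
    exact Nat.eq_of_mul_eq_mul_left two_pos htower
  obtain ⟨H, hH⟩ := Sylow.exists_subgroup_card_pow_prime (G := Gal(N/C)) 2 (n := n)
    (hcard ▸ pow_dvd_pow 2 n.le_succ)
  refine finrank_ne_two_of_forall_isSquare (C := C) (M := IntermediateField.fixedField H)
    isSquare_quadraticAlgebra ?_
  have h1 := Module.finrank_mul_finrank C (IntermediateField.fixedField H) N
  rw [IntermediateField.finrank_fixedField_eq_card, hH, ← IsGalois.card_aut_eq_finrank C N, hcard,
    pow_succ'] at h1
  exact Nat.eq_of_mul_eq_mul_right (by positivity) h1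

/-- The field `R(i)` is algebraically closed: the Galois closure over `R` of a simple extension of
`R(i)` is `R(i)` itself. -/
instance isAlgClosed_quadraticAlgebra : IsAlgClosed (QuadraticAlgebra R (-1) 0) := by
  set C := QuadraticAlgebra R (-1) 0 with hCdef
  refine IsAlgClosed.of_exists_root _ fun p hp hirr => ?_
  have := Fact.mk hirr
  have : FiniteDimensional C (AdjoinRoot p) := (AdjoinRoot.powerBasis hirr.ne_zero).finite
  have : FiniteDimensional R (AdjoinRoot p) := FiniteDimensional.trans R C _
  let Ω := AlgebraicClosure (AdjoinRoot p)
  let N := IntermediateField.normalClosure R (AdjoinRoot p) Ω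
  let : Algebra (AdjoinRoot p) N := normalClosure.algebra R (AdjoinRoot p) Ω
  have : IsScalarTower R (AdjoinRoot p) N := inferInstance
  let : Algebra C N := ((algebraMap (AdjoinRoot p) N).comp (algebraMap C (AdjoinRoot p))).toAlgebra
  have : IsScalarTower C (AdjoinRoot p) N := IsScalarTower.of_algebraMap_eq fun _ => rfl
  have : IsScalarTower R C N := IsScalarTower.of_algebraMap_eq fun x => by
    rw [IsScalarTower.algebraMap_apply C (AdjoinRoot p) N,
      ← IsScalarTower.algebraMap_apply R C (AdjoinRoot p),
      ← IsScalarTower.algebraMap_apply R (AdjoinRoot p) N]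
  have : Normal R N := normalClosure.normal R (AdjoinRoot p) Ω
  have : IsGalois R N := ⟨⟩
  have h1 := finrank_eq_one_of_isGalois (R := R) (N := N)
  have h2 := Module.finrank_mul_finrank C (AdjoinRoot p) N
  rw [h1] at h2
  have h3 := Nat.eq_one_of_mul_eq_one_right h2
  rw [(AdjoinRoot.powerBasis hirr.ne_zero).finrank, AdjoinRoot.powerBasis_dim] at h3
  exact Polynomial.exists_root_of_degree_eq_one
    (Polynomial.degree_eq_iff_natDegree_eq hirr.ne_zero |>.2 h3)

theorem natDegree_le_two_of_irreducible {p : Polynomial R} (hp : Irreducible p) :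
    p.natDegree ≤ 2 := by
  set C := QuadraticAlgebra R (-1) 0 with hCdef
  obtain ⟨z, hz⟩ := IsAlgClosed.exists_aeval_eq_zero C p
    (Polynomial.degree_pos_of_irreducible hp).ne'
  have h1 : p.natDegree = (minpoly R z).natDegree := by
    rw [← minpoly.eq_of_irreducible hp hz, Polynomial.natDegree_mul_C]
    simp [hp.ne_zero]
  rw [h1, ← QuadraticAlgebra.finrank_eq_two (R := R) (-1) 0]
  exact minpoly.natDegree_le z

end AlgClosed

end IsRealClosed

/-! ### Real embeddings and the signature of the trace form -/

namespace IsRealClosed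

/-- Fewer linear equations than unknowns: a homogeneous system indexed by `U` has a nonzero
solution supported on `S` when `#U < #S`. -/
theorem exists_ne_zero_supported_of_card_lt {R ι κ : Type*} [Field R] [Fintype ι] [DecidableEq ι]
    {S : Finset ι} {U : Finset κ} (h : U.card < S.card) (w : κ → ι → R) :
    ∃ c : ι → R, c ≠ 0 ∧ (∀ i ∉ S, c i = 0) ∧ ∀ k ∈ U, ∑ i, c i * w k i = 0 := by
  let f : (S → R) →ₗ[R] (U → R) := Matrix.mulVecLin (Matrix.of fun k i => w k i)
  have hker : LinearMap.ker f ≠ ⊥ := LinearMap.ker_ne_bot_of_finrank_lt (by simpa using h)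
  obtain ⟨c, hc, hc0⟩ := (Submodule.ne_bot_iff _).1 hker
  refine ⟨fun i => if h : i ∈ S then c ⟨i, h⟩ else 0, fun h0 => hc0 ?_, fun i hi => by simp [hi],
    fun k hk => ?_⟩
  · ext i
    simpa using congrFun h0 i
  · have := congrFun (LinearMap.mem_ker.1 hc) ⟨k, hk⟩
    simp only [f, Matrix.mulVecLin_apply, Matrix.mulVec, dotProduct, Matrix.of_apply,
      Pi.zero_apply] at this
    rw [← Finset.sum_subset (Finset.subset_univ S) fun i _ hi => by simp [hi],
      ← Finset.sum_coe_sort, ← this]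
    exact Finset.sum_congr rfl fun i _ => by simp [mul_comm]

section Conjugation

variable {E A R : Type*} [Field E] [Field A] [Algebra E A] [Field R] [LinearOrder R]
  [IsStrictOrderedRing R] [Algebra E R]

/-- Composition with conjugation, as a map on the embeddings of `A` into `R(i)`. -/
noncomputable def conjEmbedding (σ : A →ₐ[E] QuadraticAlgebra R (-1) 0) :
    A →ₐ[E] QuadraticAlgebra R (-1) 0 :=
  AlgHom.comp
    { toRingHom := starRingEnd (QuadraticAlgebra R (-1) 0)
      commutes' := fun r => by
        rw [IsScalarTower.algebraMap_apply E R]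
        ext <;> simp [starRingEnd_apply] } σ

theorem conjEmbedding_apply (σ : A →ₐ[E] QuadraticAlgebra R (-1) 0) (a : A) :
    conjEmbedding σ a = star (σ a) := rfl

theorem conjEmbedding_conjEmbedding (σ : A →ₐ[E] QuadraticAlgebra R (-1) 0) :
    conjEmbedding (conjEmbedding σ) = σ := by
  ext a <;> simp [conjEmbedding_apply]

/-- The embeddings into `R` are the embeddings into `R(i)` fixed by conjugation. -/
theorem nonempty_algHom_iff_exists_conjEmbedding_eq :
    Nonempty (A →ₐ[E] R) ↔ ∃ σ : A →ₐ[E] QuadraticAlgebra R (-1) 0, conjEmbedding σ = σ := by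
  constructor
  · rintro ⟨τ⟩
    refine ⟨(IsScalarTower.toAlgHom E R (QuadraticAlgebra R (-1) 0)).comp τ, ?_⟩
    ext a <;> simp [conjEmbedding_apply]
  · rintro ⟨σ, hσ⟩
    have him : ∀ a, (σ a).im = 0 := fun a => by
      have := congrArg QuadraticAlgebra.im (DFunLike.congr_fun hσ a)
      simp only [conjEmbedding_apply, QuadraticAlgebra.im_star] at this
      linarith
    exact ⟨{ toFun := fun a => (σ a).re
             map_one' := by rw [map_one]; rfl
             map_mul' := fun a b => by simp [him]
             map_zero' := by simp
             map_add' := fun a b => by simp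
             commutes' := fun r => by
               rw [σ.commutes, IsScalarTower.algebraMap_apply E R]; simp }⟩

end Conjugation

section Signature

variable {E A R : Type*} [Field E] [Field A] [Algebra E A] [FiniteDimensional E A]
  [Algebra.IsSeparable E A] [Field R] [LinearOrder R] [IsStrictOrderedRing R] [IsRealClosed R]
  [Algebra E R] {ι : Type*} [Fintype ι]

/-- The trace form, evaluated at an `R`-combination of an orthogonal basis, is the sum of the
squares of its images under the embeddings into `R(i)`. -/
theorem sum_trace_mul_sq (v : Module.Basis ι E A) (hv : (Algebra.traceForm E A).IsOrthoᵢ v)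
    (c : ι → R) :
    ∑ i, algebraMap E R (Algebra.trace E A (v i * v i)) * c i ^ 2 =
      ∑ σ : A →ₐ[E] QuadraticAlgebra R (-1) 0,
        ((∑ i, c i * (σ (v i)).re) ^ 2 - (∑ i, c i * (σ (v i)).im) ^ 2) := by
  classical
  set C := QuadraticAlgebra R (-1) 0
  have key : ∑ i, algebraMap R C (algebraMap E R (Algebra.trace E A (v i * v i)) * c i ^ 2) =
      ∑ σ : A →ₐ[E] C, (∑ i, c i • σ (v i)) ^ 2 := by
    calc _ = ∑ i, ∑ j, algebraMap R C (c i * c j) *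
          algebraMap E C (Algebra.trace E A (v i * v j)) := by
          refine Finset.sum_congr rfl fun i _ => ?_
          rw [Finset.sum_eq_single i]
          · rw [IsScalarTower.algebraMap_apply E R C, ← map_mul (algebraMap R C)]
            congr 1; ring
          · intro j _ hj
            have : Algebra.trace E A (v i * v j) = 0 := hv hj.symm
            simp [this]
          · simp
      _ = ∑ i, ∑ j, ∑ σ : A →ₐ[E] C, (c i • σ (v i)) * (c j • σ (v j)) := by
          refine Finset.sum_congr rfl fun i _ => Finset.sum_congr rfl fun j _ => ?_
          rw [trace_eq_sum_embeddings C, Finset.mul_sum]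
          refine Finset.sum_congr rfl fun σ _ => ?_
          rw [map_mul, map_mul, Algebra.smul_def, Algebra.smul_def]
          ring
      _ = _ := by
          simp_rw [pow_two, Finset.sum_mul_sum]
          rw [Finset.sum_comm]
          simp_rw [Finset.sum_comm (s := Finset.univ (α := ι)) (t := Finset.univ (α := A →ₐ[E] C))]
          exact Finset.sum_congr rfl fun σ _ => Finset.sum_comm
  have hre := congrArg (QuadraticAlgebra.reₗ (R := R) (-1) 0) key
  rw [map_sum, map_sum] at hre
  have h : ∀ σ : A →ₐ[E] C, QuadraticAlgebra.reₗ (-1) 0 ((∑ i, c i • σ (v i)) ^ 2) =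
      (∑ i, c i * (σ (v i)).re) ^ 2 - (∑ i, c i * (σ (v i)).im) ^ 2 := fun σ => by
    have h1 : (∑ i, c i • σ (v i)).re = ∑ i, c i * (σ (v i)).re :=
      map_sum (QuadraticAlgebra.reₗ (R := R) (-1) 0) _ _
    have h2 : (∑ i, c i • σ (v i)).im = ∑ i, c i * (σ (v i)).im :=
      map_sum (QuadraticAlgebra.imₗ (R := R) (-1) 0) _ _
    rw [← h1, ← h2, QuadraticAlgebra.reₗ_apply, pow_two, QuadraticAlgebra.re_mul]
    ring
  simp_rw [h] at hre
  exact hre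

variable [LinearOrder E] [IsStrictOrderedRing E]

/-- Sylvester's criterion for real embeddings: the trace form of `A` over the ordered field `E`,
diagonalized by `v`, has more positive than negative entries exactly when `A` embeds into the
real-closed extension `R` of `E`. The criterion does not mention `R`. -/
theorem nonempty_algHom_iff_card_neg_lt_card_pos (hpos : ∀ x : E, 0 < x → 0 < algebraMap E R x)
    (v : Module.Basis ι E A) (hv : (Algebra.traceForm E A).IsOrthoᵢ v) :
    Nonempty (A →ₐ[E] R) ↔
      (Finset.univ.filter fun i => Algebra.trace E A (v i * v i) < 0).card <
        (Finset.univ.filter fun i => 0 < Algebra.trace E A (v i * v i)).card := by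
  classical
  rw [nonempty_algHom_iff_exists_conjEmbedding_eq]
  set H := A →ₐ[E] QuadraticAlgebra R (-1) 0
  let d : ι → E := fun i => Algebra.trace E A (v i * v i)
  change _ ↔ (Finset.univ.filter fun i => d i < 0).card < (Finset.univ.filter fun i => 0 < d i).card
  set N := Finset.univ.filter fun i => d i < 0 with hN
  set P := Finset.univ.filter fun i => 0 < d i with hP
  let _ : LinearOrder H := linearOrderOfSTO (WellOrderingRel (α := H))
  -- a transversal of the conjugate pairs, its conjugate, and the real embeddings
  let T := Finset.univ.filter fun σ : H => σ < conjEmbedding σ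
  let T' := Finset.univ.filter fun σ : H => conjEmbedding σ < σ
  let F := Finset.univ.filter fun σ : H => conjEmbedding σ = σ
  have hT : T'.card = T.card := by
    refine Finset.card_bij (fun σ _ => conjEmbedding σ) (fun σ hσ => ?_)
      (fun σ _ τ _ h => ?_) (fun σ hσ => ⟨conjEmbedding σ, ?_, conjEmbedding_conjEmbedding σ⟩)
    · simpa [T, T', conjEmbedding_conjEmbedding] using hσ
    · rw [← conjEmbedding_conjEmbedding σ, h, conjEmbedding_conjEmbedding]
    · simpa [T, T', conjEmbedding_conjEmbedding] using hσ
  have hTF : Disjoint T F := Finset.disjoint_filter.2 fun σ _ h h' => h.ne h'.symm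
  have hH : 2 * T.card + F.card = Fintype.card ι := by
    have h1 : Finset.univ = (T ∪ F) ∪ T' := by
      ext σ
      rcases lt_trichotomy σ (conjEmbedding σ) with h | h | h
      · simp [T, h]
      · simp [F, h.symm]
      · simp [T', h]
    have h2 : Disjoint (T ∪ F) T' := by
      refine Finset.disjoint_union_left.2 ⟨Finset.disjoint_filter.2 fun σ _ h h' => h.not_gt h',
        Finset.disjoint_filter.2 fun σ _ h h' => h'.ne h⟩
    have h3 : Fintype.card H = Fintype.card ι := by
      rw [AlgHom.card, Module.finrank_eq_card_basis v]
    rw [← h3, ← Finset.card_univ, h1, Finset.card_union_of_disjoint h2,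
      Finset.card_union_of_disjoint hTF, hT]
    ring
  have hd0 : ∀ i, d i ≠ 0 := fun i =>
    LinearMap.IsOrthoᵢ.not_isOrtho_basis_self_of_separatingLeft hv
      (traceForm_nondegenerate E A).1 i
  have hNP : N.card + P.card = Fintype.card ι := by
    rw [← Finset.card_union_of_disjoint (Finset.disjoint_filter.2 fun i _ h h' => h.not_gt h'),
      ← Finset.card_univ]
    congr 1
    ext i
    rcases (hd0 i).lt_or_gt with h | h <;> simp [h]
  have hneg : ∀ x : E, x < 0 → algebraMap E R x < 0 := fun x hx => by
    simpa using hpos (-x) (by simpa using hx)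
  have hre : ∀ c : ι → R, ∀ σ : H,
      ∑ i, c i * (conjEmbedding σ (v i)).re = ∑ i, c i * (σ (v i)).re := fun c σ => by
    simp [conjEmbedding_apply]
  have him : ∀ c : ι → R, ∀ σ : H,
      ∑ i, c i * (conjEmbedding σ (v i)).im = -∑ i, c i * (σ (v i)).im := fun c σ => by
    simp [conjEmbedding_apply]
  have hPle : P.card ≤ T.card + F.card := by
    rw [← Finset.card_union_of_disjoint hTF]
    by_contra! hlt
    obtain ⟨c, hc0, hcP, hc⟩ := exists_ne_zero_supported_of_card_lt hlt
      (fun (σ : H) i => (σ (v i)).re)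
    have hc' : ∀ σ : H, ∑ i, c i * (σ (v i)).re = 0 := fun σ => by
      rcases lt_trichotomy σ (conjEmbedding σ) with h | h | h
      · exact hc σ (by simp [T, h])
      · exact hc σ (by simp [F, h.symm])
      · rw [← hre]
        exact hc _ (by simp [T, h, conjEmbedding_conjEmbedding])
    have hsum := sum_trace_mul_sq (R := R) v hv c
    obtain ⟨i, hi⟩ := Function.ne_iff.1 hc0
    have h1 : 0 < ∑ i, algebraMap E R (d i) * c i ^ 2 := by
      refine Finset.sum_pos' (fun j _ => ?_) ⟨i, Finset.mem_univ _, ?_⟩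
      · by_cases hj : j ∈ P
        · exact mul_nonneg (hpos _ (Finset.mem_filter.1 hj).2).le (sq_nonneg _)
        · simp [hcP j hj]
      · have hiP : i ∈ P := by
          by_contra h
          exact hi (hcP i h)
        exact mul_pos (hpos _ (Finset.mem_filter.1 hiP).2) (sq_pos_of_ne_zero hi)
    refine h1.not_ge (hsum.trans_le (Finset.sum_nonpos fun σ _ => ?_))
    rw [hc' σ]
    nlinarith [sq_nonneg (∑ i, c i * (σ (v i)).im)]
  have hNle : N.card ≤ T.card := by
    by_contra! hlt
    obtain ⟨c, hc0, hcN, hc⟩ := exists_ne_zero_supported_of_card_lt hlt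
      (fun (σ : H) i => (σ (v i)).im)
    have hc' : ∀ σ : H, ∑ i, c i * (σ (v i)).im = 0 := fun σ => by
      rcases lt_trichotomy σ (conjEmbedding σ) with h | h | h
      · exact hc σ (by simp [T, h])
      · have := him c σ
        rw [← h] at this
        linarith
      · have := hc (conjEmbedding σ) (by simp [T, h, conjEmbedding_conjEmbedding])
        rw [him] at this
        linarith
    have hsum := sum_trace_mul_sq (R := R) v hv c
    obtain ⟨i, hi⟩ := Function.ne_iff.1 hc0
    have h1 : ∑ i, algebraMap E R (d i) * c i ^ 2 < 0 := by
      refine Finset.sum_neg' (fun j _ => ?_) ⟨i, Finset.mem_univ _, ?_⟩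
      · by_cases hj : j ∈ N
        · exact mul_nonpos_of_nonpos_of_nonneg (hneg _ (Finset.mem_filter.1 hj).2).le (sq_nonneg _)
        · simp [hcN j hj]
      · have hiN : i ∈ N := by
          by_contra h
          exact hi (hcN i h)
        exact mul_neg_of_neg_of_pos (hneg _ (Finset.mem_filter.1 hiN).2) (sq_pos_of_ne_zero hi)
    refine h1.not_ge ((Finset.sum_nonneg fun σ _ => ?_).trans_eq hsum.symm)
    rw [hc' σ]
    nlinarith [sq_nonneg (∑ i, c i * (σ (v i)).re)]
  have hF : (∃ σ : H, conjEmbedding σ = σ) ↔ 0 < F.card := by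
    rw [Finset.card_pos, Finset.filter_nonempty_iff]
    simp
  rw [hF]
  omega

end Signature

/-- An algebraic extension of an ordered field `E` which embeds into one real-closed field ordering
`E` as given embeds into every other one. -/
theorem nonempty_algHom_of_isAlgebraic {E R S : Type*} [Field E] [LinearOrder E]
    [IsStrictOrderedRing E] [Field R] [LinearOrder R] [IsStrictOrderedRing R] [IsRealClosed R]
    [Field S] [LinearOrder S] [IsStrictOrderedRing S] [IsRealClosed S] [Algebra E R] [Algebra E S]
    (hR : ∀ x : E, 0 < x → 0 < algebraMap E R x) (hS : ∀ x : E, 0 < x → 0 < algebraMap E S x)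
    (A : IntermediateField E R) [Algebra.IsAlgebraic E A] : Nonempty (A →ₐ[E] S) := by
  refine Field.nonempty_algHom_of_exists_root fun x => ?_
  have hx : IsIntegral E x := Algebra.IsIntegral.isIntegral x
  have : FiniteDimensional E (IntermediateField.adjoin E {x}) :=
    IntermediateField.adjoin.finiteDimensional hx
  have : Invertible (2 : E) := invertibleOfNonzero two_ne_zero
  obtain ⟨v, hv⟩ := LinearMap.BilinForm.exists_orthogonal_basis
    (B := Algebra.traceForm E (IntermediateField.adjoin E {x}))
    ⟨fun y z => congrArg (Algebra.trace E _) (mul_comm y z)⟩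
  have h1 : Nonempty (IntermediateField.adjoin E {x} →ₐ[E] R) :=
    ⟨A.val.comp (IntermediateField.val _)⟩
  rw [nonempty_algHom_iff_card_neg_lt_card_pos hR v hv,
    ← nonempty_algHom_iff_card_neg_lt_card_pos hS v hv] at h1
  obtain ⟨τ⟩ := h1
  refine ⟨τ (IntermediateField.AdjoinSimple.gen E x), ?_⟩
  rw [Polynomial.aeval_algHom_apply]
  have : Polynomial.aeval (IntermediateField.AdjoinSimple.gen E x) (minpoly E x) = 0 := by
    rw [← IntermediateField.minpoly_gen E x, minpoly.aeval]
  rw [this, map_zero]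

end IsRealClosed

/-! ### Signs of polynomials in a cut -/

namespace IsRealClosed

/-- The relative algebraic closure of a subfield in a real-closed field is real closed. -/
theorem isRealClosed_algebraicClosure (E K : Type*) [Field E] [Field K] [LinearOrder K]
    [IsStrictOrderedRing K] [IsRealClosed K] [Algebra E K] :
    IsRealClosed (algebraicClosure E K) := by
  have hmem : ∀ x : K, IsAlgebraic (algebraicClosure E K) x → x ∈ algebraicClosure E K :=
    fun x hx => mem_algebraicClosure_iff.2 (hx.restrictScalars E)
  refine of_linearOrderedField (fun {x} hx => ?_) fun {f} hf => ?_
  · obtain ⟨y, hy⟩ := IsSquare.of_nonneg (R := K) (x := x) hx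
    have hy' : IsAlgebraic (algebraicClosure E K) y := by
      refine (IsAlgebraic.of_pow (n := 2) two_pos ?_)
      rw [pow_two, ← hy]
      exact isAlgebraic_algebraMap x
    exact ⟨⟨y, hmem y hy'⟩, Subtype.ext hy⟩
  · obtain ⟨y, hy⟩ := exists_isRoot_of_odd_natDegree (R := K)
      (f := f.map (algebraMap (algebraicClosure E K) K)) (by simpa using hf)
    have hf0 : f ≠ 0 := by rintro rfl; simp at hf
    have hy' : Polynomial.aeval y f = 0 := by
      rwa [Polynomial.IsRoot, Polynomial.eval_map_algebraMap] at hy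
    refine ⟨⟨y, hmem y ⟨f, hf0, hy'⟩⟩, ?_⟩
    refine (algebraMap (algebraicClosure E K) K).injective ?_
    rw [← Polynomial.aeval_algebraMap_apply_eq_algebraMap_eval, map_zero]
    exact hy'

/-- The discriminant of an irreducible quadratic polynomial over a real-closed field is negative. -/
theorem discrim_neg_of_irreducible {R : Type*} [Field R] [LinearOrder R] [IsStrictOrderedRing R]
    [IsRealClosed R] {p : Polynomial R} (hp : Irreducible p) (hdeg : p.natDegree = 2) :
    discrim (p.coeff 2) (p.coeff 1) (p.coeff 0) < 0 := by
  by_contra! h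
  obtain ⟨s, hs⟩ := IsSquare.of_nonneg h
  have h2 : p.coeff 2 ≠ 0 := by
    rw [← hdeg]; exact Polynomial.leadingCoeff_ne_zero.2 hp.ne_zero
  obtain ⟨x, hx⟩ := exists_quadratic_eq_zero h2 ⟨s, hs⟩
  have hroot : p.IsRoot x := by
    rw [Polynomial.IsRoot, Polynomial.eval_eq_sum_range, hdeg]
    simp only [Finset.sum_range_succ, Finset.sum_range_zero]
    linear_combination hx
  have := Polynomial.natDegree_eq_of_degree_eq_some
    (Polynomial.degree_eq_one_of_irreducible_of_root hp hroot)
  rw [hdeg] at this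
  exact absurd this (by decide)

theorem aeval_eq_of_natDegree_eq_one {R L : Type*} [Field R] [Field L] [Algebra R L]
    {q : Polynomial R} (h : q.natDegree = 1) (y : L) :
    Polynomial.aeval y q =
      algebraMap R L q.leadingCoeff * (y - algebraMap R L (-q.coeff 0 / q.leadingCoeff)) := by
  have h0 : algebraMap R L q.leadingCoeff ≠ 0 := by
    have : q ≠ 0 := by rintro rfl; simp at h
    simpa using this
  rw [Polynomial.aeval_eq_sum_range, h]
  simp only [Finset.sum_range_succ, Finset.sum_range_zero, Algebra.smul_def, map_div₀, map_neg]
  rw [Polynomial.leadingCoeff, h] at h0 ⊢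
  field_simp
  ring

theorem leadingCoeff_mul_aeval_pos {R L : Type*} [Field R] [LinearOrder R]
    [IsStrictOrderedRing R] [IsRealClosed R] [Field L] [LinearOrder L] [IsStrictOrderedRing L]
    [Algebra R L] (hL : ∀ x : R, 0 < x → 0 < algebraMap R L x) {q : Polynomial R}
    (hq : Irreducible q) (h : q.natDegree = 2) (y : L) :
    0 < algebraMap R L q.leadingCoeff * Polynomial.aeval y q := by
  have hd := hL _ (neg_pos.2 (discrim_neg_of_irreducible hq h))
  rw [Polynomial.aeval_eq_sum_range, Polynomial.leadingCoeff, h]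
  simp only [Finset.sum_range_succ, Finset.sum_range_zero, Algebra.smul_def]
  simp only [discrim, map_neg, map_sub, map_pow, map_mul, map_ofNat] at hd
  -- `4 * a * (a * y ^ 2 + b * y + c) = (2 * a * y + b) ^ 2 - (b ^ 2 - 4 * a * c)`
  nlinarith [sq_nonneg (2 * algebraMap R L (q.coeff 2) * y + algebraMap R L (q.coeff 1))]

section SameSign

/-- Both entries of a pair are positive, or both are negative. -/
def SameSign {K F : Type*} [Zero K] [Preorder K] [Zero F] [Preorder F] (a : K) (b : F) :
    Prop :=
  (0 < a ∧ 0 < b) ∨ (a < 0 ∧ b < 0)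

theorem SameSign.pos_iff {K F : Type*} [Zero K] [Preorder K] [Zero F] [Preorder F]
    {a : K} {b : F} (h : SameSign a b) : 0 < a ↔ 0 < b := by
  rcases h with ⟨h1, h2⟩ | ⟨h1, h2⟩
  · exact ⟨fun _ => h2, fun _ => h1⟩
  · exact ⟨fun h => absurd h1 h.not_gt, fun h => absurd h2 h.not_gt⟩

variable {R K F : Type*} [Field R] [LinearOrder R] [IsStrictOrderedRing R]
  [Field K] [LinearOrder K] [IsStrictOrderedRing K] [Algebra R K]
  [Field F] [LinearOrder F] [IsStrictOrderedRing F] [Algebra R F]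

theorem SameSign.mul {a a' : K} {b b' : F} (h : SameSign a b) (h' : SameSign a' b') :
    SameSign (a * a') (b * b') := by
  rcases h with ⟨h1, h2⟩ | ⟨h1, h2⟩ <;> rcases h' with ⟨h3, h4⟩ | ⟨h3, h4⟩
  · exact .inl ⟨mul_pos h1 h3, mul_pos h2 h4⟩
  · exact .inr ⟨mul_neg_of_pos_of_neg h1 h3, mul_neg_of_pos_of_neg h2 h4⟩
  · exact .inr ⟨mul_neg_of_neg_of_pos h1 h3, mul_neg_of_neg_of_pos h2 h4⟩
  · exact .inl ⟨mul_pos_of_neg_of_neg h1 h3, mul_pos_of_neg_of_neg h2 h4⟩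

theorem sameSign_algebraMap (hK : ∀ x : R, 0 < x → 0 < algebraMap R K x)
    (hF : ∀ x : R, 0 < x → 0 < algebraMap R F x) {x : R} (hx : x ≠ 0) :
    SameSign (algebraMap R K x) (algebraMap R F x) := by
  rcases hx.lt_or_gt with h | h
  · exact .inr ⟨by simpa using hK (-x) (by simpa using h),
      by simpa using hF (-x) (by simpa using h)⟩
  · exact .inl ⟨hK x h, hF x h⟩

/-- Over a real-closed field `R`, polynomials have the same sign at points of ordered extensions
that lie in the same cut of `R`: linear factors by the choice of the cut, and irreducible quadratic
factors because they have constant sign. -/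
theorem sameSign_aeval [IsRealClosed R] (hK : ∀ x : R, 0 < x → 0 < algebraMap R K x)
    (hF : ∀ x : R, 0 < x → 0 < algebraMap R F x) {a : K} {b : F}
    (hab : ∀ e : R, SameSign (a - algebraMap R K e) (b - algebraMap R F e))
    (p : Polynomial R) (hp : p ≠ 0) :
    SameSign (Polynomial.aeval a p) (Polynomial.aeval b p) := by
  induction p using WfDvdMonoid.induction_on_irreducible with
  | zero => exact absurd rfl hp
  | unit p hu =>
    obtain ⟨c, hc, rfl⟩ := Polynomial.isUnit_iff.1 hu
    simpa using sameSign_algebraMap hK hF hc.ne_zero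
  | mul p q hp0 hq ih =>
    rw [map_mul, map_mul]
    refine SameSign.mul ?_ (ih hp0)
    have h1 := hq.natDegree_pos
    have h2 := natDegree_le_two_of_irreducible hq
    have h0 := sameSign_algebraMap hK hF (Polynomial.leadingCoeff_ne_zero.2 hq.ne_zero)
    obtain h | h : q.natDegree = 1 ∨ q.natDegree = 2 := by omega
    · rw [aeval_eq_of_natDegree_eq_one h, aeval_eq_of_natDegree_eq_one h]
      exact h0.mul (hab _)
    · have ha := leadingCoeff_mul_aeval_pos hK hq h a
      have hb := leadingCoeff_mul_aeval_pos hF hq h b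
      rcases h0 with ⟨h3, h4⟩ | ⟨h3, h4⟩
      · exact .inl ⟨(pos_iff_pos_of_mul_pos ha).1 h3, (pos_iff_pos_of_mul_pos hb).1 h4⟩
      · exact .inr ⟨(neg_iff_neg_of_mul_pos ha).1 h3, (neg_iff_neg_of_mul_pos hb).1 h4⟩

end SameSign

end IsRealClosed

/-! ### Extending countable partial isomorphisms -/

section PartialIso

variable {K : Type w} {F : Type x} [Field K] [LinearOrder K] [IsStrictOrderedRing K]
  [Field F] [LinearOrder F] [IsStrictOrderedRing F]

/-- A countable partial isomorphism between ordered fields, given by its graph: a countable subring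
of `K × F` whose elements have first and second entries of equal sign. Both projections are then
injective on it. -/
structure IsPartialIso (G : Subring (K × F)) : Prop where
  countable : (G : Set (K × F)).Countable
  pos_iff : ∀ z ∈ G, 0 < z.1 ↔ 0 < z.2

theorem fst_eq_zero_iff_of_pos_iff {G : Subring (K × F)} (h : ∀ z ∈ G, 0 < z.1 ↔ 0 < z.2)
    {z : K × F} (hz : z ∈ G) : z.1 = 0 ↔ z.2 = 0 := by
  have h1 := h z hz
  have h2 := h (-z) (neg_mem hz)
  simp only [Prod.fst_neg, Prod.snd_neg, neg_pos] at h2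
  constructor
  · intro h0
    exact le_antisymm (not_lt.1 fun h => (h1.2 h).ne' h0) (not_lt.1 fun h => (h2.2 h).ne h0)
  · intro h0
    exact le_antisymm (not_lt.1 fun h => (h1.1 h).ne' h0) (not_lt.1 fun h => (h2.1 h).ne h0)

/-- Every cut of `F` between countable sets is filled. -/
def FillsCountableCuts (F : Type*) [LT F] : Prop :=
  ∀ A B : Set F, A.Countable → B.Countable → (∀ x ∈ A, ∀ y ∈ B, x < y) →
    ∃ c, (∀ x ∈ A, x < c) ∧ ∀ y ∈ B, c < y

open IsRealClosed in
/-- The extension step over a real-closed field of definition: the point `a` lies in `R`,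
or it is matched with a point `b` in the corresponding cut. -/
theorem exists_isPartialIso_of_isRealClosed (hF : FillsCountableCuts F) {R : Type*} [Field R]
    [LinearOrder R] [IsStrictOrderedRing R] [IsRealClosed R] [Countable R] [Algebra R K]
    [Algebra R F] (hRK : ∀ x : R, 0 < x → 0 < algebraMap R K x)
    (hRF : ∀ x : R, 0 < x → 0 < algebraMap R F x) (a : K) :
    ∃ G : Subring (K × F), IsPartialIso G ∧ (∀ x, (algebraMap R K x, algebraMap R F x) ∈ G) ∧
      ∃ b, (a, b) ∈ G := by
  by_cases ha : a ∈ Set.range (algebraMap R K)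
  · obtain ⟨e, rfl⟩ := ha
    refine ⟨((algebraMap R K).prod (algebraMap R F)).range, ⟨?_, ?_⟩, fun x => ⟨x, rfl⟩,
      ⟨algebraMap R F e, e, rfl⟩⟩
    · exact Set.countable_range _
    · rintro _ ⟨x, rfl⟩
      by_cases hx : x = 0
      · simp [hx]
      · exact (sameSign_algebraMap hRK hRF hx).pos_iff
  have hmono : ∀ x y : R, algebraMap R K x < algebraMap R K y →
      algebraMap R F x < algebraMap R F y := fun x y h => by
      have : x < y := by
        by_contra! hle
        rcases hle.eq_or_lt with rfl | hlt
        · exact h.false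
        · have := hRK (x - y) (sub_pos.2 hlt)
          rw [map_sub, sub_pos] at this
          exact h.not_gt this
      have := hRF (y - x) (sub_pos.2 this)
      rwa [map_sub, sub_pos] at this
  obtain ⟨b, hb1, hb2⟩ := hF (algebraMap R F '' {e | algebraMap R K e < a})
    (algebraMap R F '' {e | a < algebraMap R K e})
    ((Set.to_countable _).image _) ((Set.to_countable _).image _) (by
      rintro _ ⟨x, hx, rfl⟩ _ ⟨y, hy, rfl⟩
      exact hmono x y (lt_trans hx hy))
  have hab : ∀ e : R, SameSign (a - algebraMap R K e) (b - algebraMap R F e) := fun e => by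
    rcases lt_trichotomy (algebraMap R K e) a with h | h | h
    · exact .inl ⟨sub_pos.2 h, sub_pos.2 (hb1 _ ⟨e, h, rfl⟩)⟩
    · exact absurd ⟨e, h⟩ ha
    · exact .inr ⟨sub_neg.2 h, sub_neg.2 (hb2 _ ⟨e, h, rfl⟩)⟩
  have : Countable (Polynomial R) :=
    ((Polynomial.toFinsuppIso R).toEquiv.trans (AddMonoidAlgebra.coeffEquiv)).injective.countable
  refine ⟨((Polynomial.aeval a).toRingHom.prod (Polynomial.aeval (R := R) b).toRingHom).range,
    ⟨Set.countable_range _, ?_⟩, fun x => ⟨Polynomial.C x, by simp⟩, b, Polynomial.X, by simp⟩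
  rintro _ ⟨p, rfl⟩
  by_cases hp : p = 0
  · simp [hp]
  · exact (sameSign_aeval hRK hRF hab p hp).pos_iff

variable [IsRealClosed K] [IsRealClosed F]

/-- The extension step over an arbitrary countable ordered field of definition: pass to its relative
algebraic closure in `K`, which embeds into `F`. -/
theorem exists_isPartialIso_of_field (hF : FillsCountableCuts F) {E : Type*} [Field E]
    [Countable E] [Algebra E K] [Algebra E F]
    (hE : ∀ x : E, 0 < algebraMap E K x → 0 < algebraMap E F x) (a : K) :
    ∃ G : Subring (K × F), IsPartialIso G ∧ (∀ x, (algebraMap E K x, algebraMap E F x) ∈ G) ∧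
      ∃ b, (a, b) ∈ G := by
  let _ : LinearOrder E := LinearOrder.lift' (algebraMap E K) (algebraMap E K).injective
  have : IsStrictOrderedRing E := Function.Injective.isStrictOrderedRing (algebraMap E K)
    (map_zero _) (map_one _) (map_add _) (map_mul _) Iff.rfl Iff.rfl
  have hpos : ∀ x : E, 0 < x → 0 < algebraMap E K x := fun x hx => by
    rw [← map_zero (algebraMap E K)]
    exact hx
  have := IsRealClosed.isRealClosed_algebraicClosure E K
  have : Countable (algebraicClosure E K) := by
    refine Set.Countable.to_subtype ((Algebraic.countable E K).mono fun x hx => ?_)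
    exact mem_algebraicClosure_iff.1 hx
  have := algebraicClosure.isAlgebraic E K
  obtain ⟨τ⟩ := IsRealClosed.nonempty_algHom_of_isAlgebraic (S := F) hpos
    (fun x hx => hE x (hpos x hx)) (algebraicClosure E K)
  let _ : Algebra (algebraicClosure E K) F := τ.toRingHom.toAlgebra
  obtain ⟨G, hG, h, hb⟩ := exists_isPartialIso_of_isRealClosed (K := K) hF
    (R := algebraicClosure E K) (fun x hx => hx) (fun x hx => by
      obtain ⟨y, rfl⟩ := IsSquare.of_nonneg hx.le
      have hy : τ y ≠ 0 := by
        rw [map_ne_zero]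
        rintro rfl
        simp at hx
      change 0 < τ (y * y)
      rw [map_mul]
      exact mul_self_pos.2 hy) a
  refine ⟨G, hG, fun x => ?_, hb⟩
  have := h (algebraMap E _ x)
  rwa [show algebraMap (algebraicClosure E K) F (algebraMap E (algebraicClosure E K) x) =
    algebraMap E F x from τ.commutes x] at this

/-- The forth step: any element of `K` can be added to the domain of a partial isomorphism. -/
theorem IsPartialIso.exists_fst_mem (hF : FillsCountableCuts F) {G : Subring (K × F)}
    (hG : IsPartialIso G) (a : K) : ∃ G', G ≤ G' ∧ IsPartialIso G' ∧ ∃ b, (a, b) ∈ G' := by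
  let π₁ : G →+* K := (RingHom.fst K F).comp G.subtype
  let π₂ : G →+* F := (RingHom.snd K F).comp G.subtype
  have h1 : Function.Injective π₁ := (injective_iff_map_eq_zero _).2 fun z hz =>
    Subtype.ext (Prod.ext hz ((fst_eq_zero_iff_of_pos_iff hG.pos_iff z.2).1 hz))
  have h2 : Function.Injective π₂ := (injective_iff_map_eq_zero _).2 fun z hz =>
    Subtype.ext (Prod.ext ((fst_eq_zero_iff_of_pos_iff hG.pos_iff z.2).2 hz) hz)
  have : IsDomain G := h1.isDomain π₁
  have : Countable G := hG.countable.to_subtype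
  have : Countable (FractionRing G) := by
    refine Function.Surjective.countable (α := G × nonZeroDivisors G)
      (f := fun z => IsLocalization.mk' (FractionRing G) z.1 z.2) fun x => ?_
    obtain ⟨y, z, h⟩ := IsLocalization.exists_mk'_eq (nonZeroDivisors G) x
    exact ⟨(y, z), h⟩
  let _ : Algebra (FractionRing G) K := (IsFractionRing.lift h1).toAlgebra
  let _ : Algebra (FractionRing G) F := (IsFractionRing.lift h2).toAlgebra
  have e1 : ∀ z, algebraMap (FractionRing G) K (algebraMap G _ z) = z.1.1 := fun z =>
    IsFractionRing.lift_algebraMap h1 z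
  have e2 : ∀ z, algebraMap (FractionRing G) F (algebraMap G _ z) = z.1.2 := fun z =>
    IsFractionRing.lift_algebraMap h2 z
  obtain ⟨G', hG', h, hb⟩ := exists_isPartialIso_of_field (K := K) hF (E := FractionRing G)
    (fun x hx => by
      obtain ⟨y, z, hz, rfl⟩ := IsFractionRing.div_surjective (A := G) x
      have hz0 : z ≠ 0 := nonZeroDivisors.ne_zero hz
      have hz1 : 0 < z.1.1 * z.1.1 := mul_self_pos.2 ((map_ne_zero_iff π₁ h1).2 hz0)
      have hz2 : 0 < z.1.2 * z.1.2 := mul_self_pos.2 ((map_ne_zero_iff π₂ h2).2 hz0)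
      rw [map_div₀, e1, e1] at hx
      rw [map_div₀, e2, e2]
      -- a quotient has the sign of the corresponding product, which lies in `G`
      have hyz : 0 < (y * z).1.1 := by
        have := mul_pos hx hz1
        rwa [div_mul_eq_mul_div, ← mul_assoc, mul_div_assoc,
          div_self (mul_self_pos.1 hz1), mul_one] at this
      have := div_pos ((hG.pos_iff _ (y * z).2).1 hyz) hz2
      have hz3 : z.1.2 ≠ 0 := mul_self_pos.1 hz2
      calc (0 : F) < _ := this
        _ = y.1.2 / z.1.2 := by
          change y.1.2 * z.1.2 / _ = _
          field_simp) a
  refine ⟨G', fun z hz => ?_, hG', hb⟩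
  have := h (algebraMap G _ ⟨z, hz⟩)
  rwa [e1, e2] at this

theorem IsPartialIso.comap_swap {K : Type*} {F : Type*} [Field K] [LinearOrder K]
    [Field F] [LinearOrder F] {G : Subring (K × F)}
    (hG : IsPartialIso G) :
    IsPartialIso (G.comap (RingEquiv.prodComm : F × K ≃+* K × F).toRingHom) where
  countable := hG.countable.preimage (RingEquiv.prodComm : F × K ≃+* K × F).injective
  pos_iff z hz := (hG.pos_iff z.swap hz).symm

/-- The back step: any element of `F` can be added to the range of a partial isomorphism. -/
theorem IsPartialIso.exists_snd_mem (hK : FillsCountableCuts K) {G : Subring (K × F)}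
    (hG : IsPartialIso G) (b : F) : ∃ G', G ≤ G' ∧ IsPartialIso G' ∧ ∃ a, (a, b) ∈ G' := by
  obtain ⟨G', hle, hG', a, ha⟩ := hG.comap_swap.exists_fst_mem hK b
  exact ⟨_, fun z hz => hle (show z.swap.swap ∈ G from hz), hG'.comap_swap, a, ha⟩

end PartialIso

/-! ### Back and forth along a well-order -/

/-- In a preorder whose countable chains are bounded, some chain meets all of a family of dense
sets, when the index set is well-ordered with countable initial segments. -/
theorem exists_isChain_forall_exists_mem {P ι : Type*} [Preorder P] [LinearOrder ι]
    [WellFoundedLT ι] (hι : ∀ i : ι, (Set.Iio i).Countable)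
    (hP : ∀ c : Set P, c.Countable → IsChain (· ≤ ·) c → ∃ u, ∀ p ∈ c, p ≤ u)
    (D : ι → P → Prop) (hD : ∀ i p, ∃ q, p ≤ q ∧ D i q) :
    ∃ c : Set P, IsChain (· ≤ ·) c ∧ ∀ i, ∃ p ∈ c, D i p := by
  classical
  obtain ⟨p₀, -⟩ := hP ∅ Set.countable_empty (by simp [IsChain])
  choose ext hext using hD
  let bound : Set P → P := fun c => if h : ∃ u, ∀ p ∈ c, p ≤ u then h.choose else p₀
  have hbound : ∀ c : Set P, (∃ u, ∀ p ∈ c, p ≤ u) → ∀ p ∈ c, p ≤ bound c := fun c h => by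
    simp only [bound, dif_pos h]
    exact h.choose_spec
  -- at stage `i`, bound all previous stages and extend into the `i`-th dense set
  let g : ι → P := wellFounded_lt.fix fun i f => ext i (bound {p | ∃ j, ∃ h : j < i, f j h = p})
  have hg : ∀ i, g i = ext i (bound (g '' Set.Iio i)) := fun i => by
    have : g '' Set.Iio i = {p | ∃ j, ∃ _ : j < i, g j = p} := by
      ext p; simp
    rw [this]
    exact wellFounded_lt.fix_eq _ i
  have hle : ∀ i, ∀ j < i, g j ≤ g i := by
    intro i
    induction i using WellFoundedLT.induction with
    | _ i ih =>
      intro j hj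
      rw [hg i]
      refine le_trans (hbound _ ?_ (g j) (Set.mem_image_of_mem g hj)) (hext _ _).1
      refine hP _ ((hι i).image g) ?_
      rintro _ ⟨k, hk, rfl⟩ _ ⟨l, hl, rfl⟩ -
      rcases lt_trichotomy k l with h | rfl | h
      · exact .inl (ih l hl k h)
      · exact .inl le_rfl
      · exact .inr (ih k hk l h)
  refine ⟨Set.range g, ?_, fun i => ⟨g i, ⟨i, rfl⟩, ?_⟩⟩
  · rintro _ ⟨k, rfl⟩ _ ⟨l, rfl⟩ -
    rcases lt_trichotomy k l with h | rfl | h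
    · exact .inl (hle l k h)
    · exact .inl le_rfl
    · exact .inr (hle k l h)
  · rw [hg i]
    exact (hext _ _).2

section PartialIso

variable {K : Type w} {F : Type x} [Field K] [LinearOrder K] [IsStrictOrderedRing K]
  [Field F] [LinearOrder F] [IsStrictOrderedRing F]

theorem isPartialIso_bot : IsPartialIso (⊥ : Subring (K × F)) where
  countable := by
    rw [Subring.coe_bot]
    exact Set.countable_range _
  pos_iff z hz := by
    obtain ⟨n, rfl⟩ := Subring.mem_bot.1 hz
    simp

/-- A countable chain of partial isomorphisms is bounded by its union. -/
theorem exists_isPartialIso_forall_le {c : Set {G : Subring (K × F) // IsPartialIso G}}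
    (hc : c.Countable) (hchain : IsChain (· ≤ ·) c) :
    ∃ u : {G : Subring (K × F) // IsPartialIso G}, ∀ p ∈ c, p ≤ u := by
  rcases c.eq_empty_or_nonempty with rfl | hne
  · exact ⟨⟨⊥, isPartialIso_bot⟩, by simp⟩
  have hdir : DirectedOn (· ≤ ·) (Subtype.val '' c) :=
    directedOn_image.2 hchain.directedOn
  refine ⟨⟨sSup (Subtype.val '' c), ?_, fun z hz => ?_⟩,
    fun p hp => le_sSup (a := p.1) (Set.mem_image_of_mem _ hp)⟩
  · rw [Subring.coe_sSup_of_directedOn (hne.image _) hdir]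
    refine (hc.image _).biUnion ?_
    rintro _ ⟨p, _, rfl⟩
    exact p.2.countable
  · obtain ⟨_, ⟨p, _, rfl⟩, hzp⟩ := (Subring.mem_sSup_of_directedOn (hne.image _) hdir).1 hz
    exact p.2.pos_iff z hzp

/-- A graph that projects onto both fields is the graph of an isomorphism. -/
theorem nonempty_ringEquiv_of_pos_iff {G : Subring (K × F)} (h : ∀ z ∈ G, 0 < z.1 ↔ 0 < z.2)
    (h₁ : ∀ a, ∃ b, (a, b) ∈ G) (h₂ : ∀ b, ∃ a, (a, b) ∈ G) : Nonempty (K ≃+* F) := by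
  let e₁ : G ≃+* K := RingEquiv.ofBijective ((RingHom.fst K F).comp G.subtype)
    ⟨(injective_iff_map_eq_zero _).2 fun z hz =>
      Subtype.ext (Prod.ext hz ((fst_eq_zero_iff_of_pos_iff h z.2).1 hz)),
      fun a => let ⟨b, hb⟩ := h₁ a; ⟨⟨_, hb⟩, rfl⟩⟩
  let e₂ : G ≃+* F := RingEquiv.ofBijective ((RingHom.snd K F).comp G.subtype)
    ⟨(injective_iff_map_eq_zero _).2 fun z hz =>
      Subtype.ext (Prod.ext ((fst_eq_zero_iff_of_pos_iff h z.2).2 hz) hz),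
      fun b => let ⟨a, ha⟩ := h₂ b; ⟨⟨_, ha⟩, rfl⟩⟩
  exact ⟨e₁.symm.trans e₂⟩

theorem exists_surjective_of_mk_le_aleph_one {K : Type w} [Nonempty K] (h : #K ≤ ℵ₁) :
    ∃ f : (Cardinal.aleph.{0} 1).ord.ToType → K, Function.Surjective f := by
  have h1 : Cardinal.lift.{0} #K ≤ Cardinal.lift.{w} #(Cardinal.aleph.{0} 1).ord.ToType := by
    simpa using h
  obtain ⟨g⟩ := Cardinal.lift_mk_le'.1 h1
  exact ⟨_, Function.invFun_surjective g.injective⟩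

/-- Real-closed fields of size at most `ℵ₁` that fill their countable cuts are isomorphic. -/
theorem nonempty_ringEquiv_of_fillsCountableCuts [IsRealClosed K] [IsRealClosed F]
    (hK : FillsCountableCuts K) (hF : FillsCountableCuts F) (hK₁ : #K ≤ ℵ₁) (hF₁ : #F ≤ ℵ₁) :
    Nonempty (K ≃+* F) := by
  obtain ⟨f₁, hf₁⟩ := exists_surjective_of_mk_le_aleph_one hK₁
  obtain ⟨f₂, hf₂⟩ := exists_surjective_of_mk_le_aleph_one hF₁
  obtain ⟨c, hc, hD⟩ := exists_isChain_forall_exists_mem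
    (P := {G : Subring (K × F) // IsPartialIso G})
    (fun i : (Cardinal.aleph.{0} 1).ord.ToType => by
      rw [← Cardinal.le_aleph0_iff_set_countable, ← Order.lt_succ_iff, Cardinal.succ_aleph0]
      simpa using Cardinal.mk_Iio_lt i (by simp))
    (fun c hc h => exists_isPartialIso_forall_le hc h)
    (fun i G => (∃ b, (f₁ i, b) ∈ G.1) ∧ ∃ a, (a, f₂ i) ∈ G.1)
    (fun i G => by
      obtain ⟨G₁, hle₁, hG₁, b, hb⟩ := G.2.exists_fst_mem hF (f₁ i)
      obtain ⟨G₂, hle₂, hG₂, a, ha⟩ := hG₁.exists_snd_mem hK (f₂ i)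
      exact ⟨⟨G₂, hG₂⟩, hle₁.trans hle₂, ⟨b, hle₂ hb⟩, a, ha⟩)
  have hdir : DirectedOn (· ≤ ·) (Subtype.val '' c) :=
    directedOn_image.2 hc.directedOn
  have hne : (Subtype.val '' c).Nonempty := by
    obtain ⟨i, -⟩ := hf₁ 0
    obtain ⟨p, hp, -⟩ := hD i
    exact ⟨_, p, hp, rfl⟩
  refine nonempty_ringEquiv_of_pos_iff (G := sSup (Subtype.val '' c)) (fun z hz => ?_)
    (fun a => ?_) fun b => ?_
  · obtain ⟨_, ⟨p, _, rfl⟩, hzp⟩ := (Subring.mem_sSup_of_directedOn hne hdir).1 hz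
    exact p.2.pos_iff z hzp
  · obtain ⟨i, rfl⟩ := hf₁ a
    obtain ⟨p, hp, ⟨b, hb⟩, -⟩ := hD i
    exact ⟨b, le_sSup (a := p.1) (Set.mem_image_of_mem _ hp) hb⟩
  · obtain ⟨i, rfl⟩ := hf₂ b
    obtain ⟨p, hp, -, a, ha⟩ := hD i
    exact ⟨a, le_sSup (a := p.1) (Set.mem_image_of_mem _ hp) ha⟩

end PartialIso

/-! ### Saturation and cuts -/

open FirstOrder FirstOrder.Language in
/-- Countable saturation in terms of formulas of `L` itself, the parameters being substituted for
additional variables. -/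
theorem isCountablySaturated_iff {L : FirstOrder.Language.{u, v}} {M : Type w} [L.Structure M] :
    IsCountablySaturated L M ↔
      ∀ A : Set M, A.Countable → ∀ (n : ℕ) (p : Set (L.Formula (A ⊕ Fin n))),
      (∀ p₀ : Finset (L.Formula (A ⊕ Fin n)), (p₀ : Set (L.Formula (A ⊕ Fin n))) ⊆ p →
        ∃ a : Fin n → M, ∀ φ ∈ p₀, φ.Realize (Sum.elim (↑) a)) →
      ∃ a : Fin n → M, ∀ φ ∈ p, φ.Realize (Sum.elim (↑) a) := by
  classical
  refine forall₃_congr fun A _ n => ?_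
  let e : L[[A]].Formula (Fin n) ≃ L.Formula (A ⊕ Fin n) := BoundedFormula.constantsVarsEquiv
  have he : ∀ (φ : L[[A]].Formula (Fin n)) (a : Fin n → M),
      (e φ).Realize (Sum.elim (↑) a) ↔ φ.Realize a := fun φ a =>
    BoundedFormula.realize_constantsVarsEquiv (M := M)
  refine (Equiv.Set.congr e).forall_congr fun {p} => ?_
  refine imp_congr ((Equiv.finsetCongr e).forall_congr fun {p₀} => imp_congr (by simp) ?_) ?_ <;>
    exact exists_congr fun a => e.forall_congr fun {φ} => by simp [he]

section Cuts

variable {K : Type w} [Field K] [LinearOrder K] [IsStrictOrderedRing K] [IsRealClosed K]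

open FirstOrder FirstOrder.Language in
/-- The formula `∃ y, (t - s) * y ^ 2 = 1`, which expresses `s < t` in a real-closed field. -/
noncomputable def ltFormula {α : Type*} (s t : α) : Language.ring.Formula α :=
  BoundedFormula.ex (n := 0) (Term.bdEqual
    ((Term.var (Sum.inl t) + -Term.var (Sum.inl s)) * (Term.var (Sum.inr 0) * Term.var (Sum.inr 0)))
    1)

open FirstOrder FirstOrder.Language in
theorem realize_ltFormula {α : Type*} (s t : α) (f : α → K) :
    letI := FirstOrder.Ring.compatibleRingOfRing K
    (ltFormula s t).Realize f ↔ f s < f t := by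
  let _ := FirstOrder.Ring.compatibleRingOfRing K
  rw [ltFormula, Formula.Realize, BoundedFormula.realize_ex]
  have h : ∀ a : K, (Fin.snoc (default : Fin 0 → K) a : Fin 1 → K) 0 = a := fun a => rfl
  simp only [BoundedFormula.realize_bdEqual, Ring.realize_mul, Ring.realize_add, Ring.realize_neg,
    Ring.realize_one, Term.realize_var, Sum.elim_inl, Sum.elim_inr, h]
  constructor
  · rintro ⟨y, hy⟩
    by_contra! hle
    linarith [mul_nonneg (sub_nonneg.2 hle) (mul_self_nonneg y)]
  · intro hlt
    obtain ⟨y, hy⟩ := IsSquare.of_nonneg (sub_pos.2 hlt).le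
    have hy0 : y ≠ 0 := by
      rintro rfl
      linarith
    refine ⟨y⁻¹, ?_⟩
    rw [← sub_eq_add_neg, hy]
    field_simp

/-- A cut is the set of formulas saying that a point lies in it; a finite part of these formulas is
satisfied because the order is dense and unbounded. -/
theorem IsCountablySaturatedField.fillsCountableCuts (h : IsCountablySaturatedField K) :
    FillsCountableCuts K := by
  classical
  intro A B hA hB hAB
  let _ := FirstOrder.Ring.compatibleRingOfRing K
  let P : Set K := A ∪ B
  let f : A ⊕ B → FirstOrder.Language.ring.Formula (P ⊕ Fin 1) := Sum.elim
    (fun e => ltFormula (Sum.inl ⟨e, Or.inl e.2⟩) (Sum.inr 0))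
    (fun e => ltFormula (Sum.inr 0) (Sum.inl ⟨e, Or.inr e.2⟩))
  obtain ⟨a, ha⟩ := isCountablySaturated_iff.1 h P (hA.union hB) 1 (Set.range f) (fun p₀ hp₀ => by
    rw [← Set.image_univ] at hp₀
    obtain ⟨s, -, rfl⟩ := Finset.subset_set_image_iff.1 hp₀
    obtain ⟨c, hc₁, hc₂⟩ := Order.exists_between_finsets
      (s.toLeft.map (Function.Embedding.subtype _))
      (s.toRight.map (Function.Embedding.subtype _)) (fun x hx y hy => by
        simp only [Finset.mem_map, Function.Embedding.subtype_apply, Subtype.exists] at hx hy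
        obtain ⟨x, hx, -, rfl⟩ := hx
        obtain ⟨y, hy, -, rfl⟩ := hy
        exact hAB x hx y hy)
    refine ⟨fun _ => c, fun φ hφ => ?_⟩
    obtain ⟨e | e, he, rfl⟩ := Finset.mem_image.1 hφ
    · exact (realize_ltFormula _ _ _).2 (hc₁ _ (Finset.mem_map.2 ⟨e, by simpa using he, rfl⟩))
    · exact (realize_ltFormula _ _ _).2 (hc₂ _ (Finset.mem_map.2 ⟨e, by simpa using he, rfl⟩)))
  exact ⟨a 0, fun e he => (realize_ltFormula _ _ _).1 (ha _ ⟨Sum.inl ⟨e, he⟩, rfl⟩),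
    fun e he => (realize_ltFormula _ _ _).1 (ha _ ⟨Sum.inr ⟨e, he⟩, rfl⟩)⟩

/-- A countable set has a strict upper bound, so it is not everything. -/
theorem FillsCountableCuts.aleph_one_le_mk {K : Type w} [Preorder K] (h : FillsCountableCuts K) :
    ℵ₁ ≤ #K := by
  rw [← Cardinal.succ_aleph0, Order.succ_le_iff]
  by_contra! hle
  have : Countable K := Cardinal.mk_le_aleph0_iff.1 hle
  obtain ⟨c, hc, -⟩ := h Set.univ ∅ (Set.to_countable _) Set.countable_empty (by simp)
  exact lt_irrefl c (hc c (Set.mem_univ c))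

end Cuts

/-! ### Countable ultrapowers -/

section Ultrapower

open FirstOrder FirstOrder.Language

/-- An ultrapower over `ℕ` in a countable language is countably saturated: a tuple realizing the
first `k` formulas is used at those indices where `k` is the largest number that works. -/
theorem isCountablySaturated_ultrapower {L : FirstOrder.Language.{u, v}} [Countable L.Symbols]
    (M : Type w) [L.Structure M] [Nonempty M] :
    IsCountablySaturated L ((Filter.hyperfilter ℕ : Filter ℕ).Product fun _ => M) := by
  classical
  rw [isCountablySaturated_iff]
  intro A hA n p hp
  have : Countable A := hA.to_subtype
  have : Countable (L.Formula (A ⊕ Fin n)) := inferInstance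
  rcases p.eq_empty_or_nonempty with rfl | hne
  · obtain ⟨a, -⟩ := hp ∅ (by simp)
    exact ⟨a, by simp⟩
  obtain ⟨φ, rfl⟩ := p.to_countable.exists_eq_range hne
  let mk : (ℕ → M) → (Filter.hyperfilter ℕ : Filter ℕ).Product fun _ => M :=
    Quotient.mk' (s := (Filter.hyperfilter ℕ : Filter ℕ).productSetoid fun _ => M)
  have hmk : Function.Surjective mk := Quotient.exists_rep
  choose r hr using fun a : A => hmk a
  have los : ∀ (ψ : L.Formula (A ⊕ Fin n)) (s : Fin n → ℕ → M),
      ψ.Realize (Sum.elim (↑) fun i => mk (s i)) ↔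
        ∀ᶠ i in (Filter.hyperfilter ℕ : Filter ℕ), ψ.Realize fun j => Sum.elim r s j i := by
    intro ψ s
    rw [← Ultraproduct.realize_formula_cast]
    refine iff_of_eq (congrArg _ (funext fun j => ?_))
    rcases j with a | j
    · exact (hr a).symm
    · rfl
  have hfin : ∀ k : ℕ, ∃ s : Fin n → ℕ → M, ∀ j ≤ k,
      (φ j).Realize (Sum.elim (↑) fun i => mk (s i)) := by
    intro k
    obtain ⟨a, ha⟩ := hp ((Finset.range (k + 1)).image φ) (by simp)
    choose s hs using fun i => hmk (a i)
    refine ⟨s, fun j hj => ?_⟩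
    simp_rw [hs]
    exact ha _ (Finset.mem_image_of_mem _ (Finset.mem_range_succ_iff.2 hj))
  choose s hs using hfin
  -- `Q i k`: at the index `i`, the `k`-th tuple satisfies the first `k + 1` formulas
  let Q : ℕ → ℕ → Prop := fun i k => ∀ j ≤ k, (φ j).Realize fun l => Sum.elim r (s k) l i
  have hQ : ∀ k, ∀ᶠ i in (Filter.hyperfilter ℕ : Filter ℕ), Q i k := fun k =>
    (Filter.eventually_all_finite (Set.finite_Iic k)).2 fun j hj => (los _ _).1 (hs k j hj)
  refine ⟨fun l => mk fun i => s (Nat.findGreatest (Q i) i) l i, ?_⟩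
  rintro _ ⟨j, rfl⟩
  rw [los]
  have hj : ∀ᶠ i in (Filter.hyperfilter ℕ : Filter ℕ), j ≤ i :=
    Nat.hyperfilter_le_atTop (Filter.eventually_ge_atTop j)
  filter_upwards [hQ j, hj] with i hi hji
  have := Nat.findGreatest_spec hji hi j (Nat.le_findGreatest hji hi)
  convert this using 2 with l
  rcases l with a | l <;> rfl

variable {R : Type w} [Field R]

theorem isCountablySaturatedField_germ :
    IsCountablySaturatedField (Filter.Germ (Filter.hyperfilter ℕ : Filter ℕ) R) := by
  let _ := FirstOrder.Ring.compatibleRingOfRing R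
  have h := isCountablySaturated_ultrapower (L := Language.ring) R
  -- the ring structure on germs and the ultraproduct structure are both computed indexwise
  have heq : (FirstOrder.Ring.compatibleRingOfRing
      (Filter.Germ (Filter.hyperfilter ℕ : Filter ℕ) R)).toStructure =
      (Ultraproduct.structure : Language.ring.Structure
        ((Filter.hyperfilter ℕ : Filter ℕ).Product fun _ => R)) := by
    refine Structure.ext ?_ ?_
    · funext k f x
      obtain ⟨y, rfl⟩ : ∃ y : Fin k → ℕ → R, x = fun i =>
          Quotient.mk' (s := (Filter.hyperfilter ℕ : Filter ℕ).productSetoid fun _ => R) (y i) := by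
        choose y hy using fun i => Quotient.exists_rep (x i)
        exact ⟨y, funext fun i => (hy i).symm⟩
      refine Eq.trans ?_ (Ultraproduct.funMap_cast (M := fun _ : ℕ => R) f y).symm
      cases f <;> rfl
    · funext k f
      exact f.elim
  rw [IsCountablySaturatedField, heq]
  exact h

/-- Nonnegative germs have indexwise square roots, and polynomials of odd degree have indexwise
roots. -/
theorem isRealClosed_germ [LinearOrder R] [IsStrictOrderedRing R] [IsRealClosed R]
    (U : Ultrafilter ℕ) : IsRealClosed (Filter.Germ (U : Filter ℕ) R) := by
  refine IsRealClosed.of_linearOrderedField (fun {x} hx => ?_) fun {f} hf => ?_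
  · induction x using Filter.Germ.inductionOn with | _ g =>
    have hx' : ∀ᶠ i in (U : Filter ℕ), 0 ≤ g i := hx
    have h : ∀ i, ∃ y, 0 ≤ g i → g i = y * y := fun i => by
      by_cases hi : 0 ≤ g i
      · obtain ⟨y, hy⟩ := IsSquare.of_nonneg hi
        exact ⟨y, fun _ => hy⟩
      · exact ⟨0, fun h => absurd h hi⟩
    choose y hy using h
    exact ⟨(y : Filter.Germ (U : Filter ℕ) R), Filter.Germ.coe_eq.2 (hx'.mono hy)⟩
  · have hf0 : f ≠ 0 := by rintro rfl; simp at hf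
    -- lift the monic associate of `f` to a family of monic polynomials of the same degree
    obtain ⟨q, hq, hdeg, hmonic⟩ := Polynomial.lifts_and_natDegree_eq_and_monic
      (f := Filter.Germ.coeRingHom (U : Filter ℕ))
      ((Polynomial.mem_lifts _).2 (Polynomial.map_surjective _ Quotient.mk_surjective _))
      (Polynomial.monic_mul_leadingCoeff_inv hf0)
    rw [Polynomial.natDegree_mul_leadingCoeff_inv f hf0] at hdeg
    have h : ∀ i, ∃ y, (q.map (Pi.evalRingHom (fun _ : ℕ => R) i)).IsRoot y := fun i =>
      IsRealClosed.exists_isRoot_of_odd_natDegree (by rwa [hmonic.natDegree_map, hdeg])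
    choose y hy using h
    have hq0 : q.eval y = 0 := funext fun i => by
      have := hy i
      rw [Polynomial.IsRoot, Polynomial.eval_map] at this
      exact (Polynomial.eval₂_at_apply (Pi.evalRingHom (fun _ : ℕ => R) i) y).symm.trans this
    refine ⟨Filter.Germ.coeRingHom (U : Filter ℕ) y, ?_⟩
    have h0 : (f * Polynomial.C f.leadingCoeff⁻¹).eval
        (Filter.Germ.coeRingHom (U : Filter ℕ) y) = 0 := by
      rw [← hq, Polynomial.eval_map, Polynomial.eval₂_at_apply, hq0, map_zero]
    rw [Polynomial.eval_mul, Polynomial.eval_C] at h0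
    exact (mul_eq_zero.1 h0).resolve_right (inv_ne_zero (Polynomial.leadingCoeff_ne_zero.2 hf0))

end Ultrapower

/-! ### The hyperreals -/

/-- A real polynomial of odd degree has an irreducible factor of odd degree, which is linear. -/
theorem Real.exists_isRoot_of_odd_natDegree (p : Polynomial ℝ) (hp : Odd p.natDegree) :
    ∃ x, p.IsRoot x := by
  induction p using WfDvdMonoid.induction_on_irreducible with
  | zero => simp at hp
  | unit p hu => simp [Polynomial.natDegree_eq_zero_of_isUnit hu] at hp
  | mul p q hp0 hq ih =>
    rw [Polynomial.natDegree_mul hq.ne_zero hp0, Nat.odd_add] at hp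
    by_cases h : Odd p.natDegree
    · obtain ⟨x, hx⟩ := ih h
      exact ⟨x, by simp [Polynomial.IsRoot, hx.eq_zero]⟩
    · have h1 := hp.2 (Nat.not_odd_iff_even.1 h)
      have h2 := hq.natDegree_le_two
      have h3 : q.natDegree = 1 := by
        rcases h1 with ⟨k, hk⟩
        omega
      obtain ⟨x, hx⟩ := Polynomial.exists_root_of_degree_eq_one
        ((Polynomial.degree_eq_iff_natDegree_eq hq.ne_zero).2 h3)
      exact ⟨x, by simp [Polynomial.IsRoot, hx.eq_zero]⟩

instance isStrictOrderedRing_ulift_real : IsStrictOrderedRing (ULift.{w} ℝ) :=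
  Function.Injective.isStrictOrderedRing ULift.down rfl rfl (fun _ _ => rfl) (fun _ _ => rfl)
    Iff.rfl Iff.rfl

instance isRealClosed_ulift_real : IsRealClosed (ULift.{w} ℝ) :=
  IsRealClosed.of_linearOrderedField
    (fun {x} hx => ⟨⟨√x.down⟩, ULift.ext _ _ (Real.mul_self_sqrt hx).symm⟩) fun {f} hf => by
    let e : ULift.{w} ℝ ≃+* ℝ := ULift.ringEquiv
    obtain ⟨x, hx⟩ := Real.exists_isRoot_of_odd_natDegree (f.map e.toRingHom)
      (by rwa [Polynomial.natDegree_map_eq_of_injective e.injective])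
    refine ⟨e.symm x, e.injective ?_⟩
    rw [map_zero, ← hx.eq_zero, Polynomial.eval_map]
    have := Polynomial.eval₂_at_apply (p := f) e.toRingHom (e.symm x)
    simp only [RingEquiv.toRingHom_eq_coe, RingEquiv.coe_toRingHom,
      RingEquiv.apply_symm_apply] at this
    exact this.symm

theorem mk_germ_ulift_real_le (l : Filter ℕ) : #(Filter.Germ l (ULift.{w} ℝ)) ≤ 𝔠 :=
  Cardinal.mk_quotient_le.trans (by simp [Cardinal.mk_real])

theorem continuum_eq_aleph_one_of_univ_zero (h : Cardinal.continuum.{0} = Cardinal.aleph.{0} 1) :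
    Cardinal.continuum.{w} = ℵ₁ := by
  rw [← Cardinal.lift_continuum.{w, 0}, h]
  simp

theorem mainTheorem1 (hCH : Cardinal.continuum.{0} = Cardinal.aleph.{0} 1) :
    ∃ (K : Type w) (_ : Field K),
      IsSmallestCountablySaturatedRCF K ∧ #K = 𝔠 ∧
        ∀ (F : Type x) [Field F], IsSmallestCountablySaturatedRCF F → Nonempty (K ≃+* F) := by
  -- the hyperreals, over a copy of `ℝ` in the given universe
  let K := Filter.Germ (Filter.hyperfilter ℕ : Filter ℕ) (ULift.{w} ℝ)
  have hK : IsRealClosed K := isRealClosed_germ _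
  have hKs : IsCountablySaturatedField K := isCountablySaturatedField_germ
  have hKc : #K ≤ 𝔠 := mk_germ_ulift_real_le _
  have hle : ∀ (F : Type w) [Field F], IsRealClosed F → IsCountablySaturatedField F → 𝔠 ≤ #F :=
    fun F _ hF hFs => by
      rw [continuum_eq_aleph_one_of_univ_zero hCH]
      let _ := IsRealClosed.linearOrder F
      have := IsRealClosed.isStrictOrderedRing (R := F)
      exact hFs.fillsCountableCuts.aleph_one_le_mk
  refine ⟨K, inferInstance, ⟨hK, hKs, fun F _ hF hFs => hKc.trans (hle F hF hFs)⟩,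
    hKc.antisymm (hle K hK hKs), fun F _ hF => ?_⟩
  have hFr := hF.isRealClosed
  have hFc : #F ≤ 𝔠 := (hF.card_le (Filter.Germ (Filter.hyperfilter ℕ : Filter ℕ) (ULift.{x} ℝ))
    (isRealClosed_germ _) isCountablySaturatedField_germ).trans (mk_germ_ulift_real_le _)
  rw [continuum_eq_aleph_one_of_univ_zero hCH] at hKc hFc
  let _ := IsRealClosed.linearOrder K
  have := IsRealClosed.isStrictOrderedRing (R := K)
  let _ := IsRealClosed.linearOrder F
  have := IsRealClosed.isStrictOrderedRing (R := F)
  exact nonempty_ringEquiv_of_fillsCountableCuts hKs.fillsCountableCuts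
    hF.isCountablySaturated.fillsCountableCuts hKc hFc
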